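/- Let $\Phi(\mathbb R)$ be the set of sequences $(\varphi_k)_{k\ge 0}\subset\mathscr S(\mathbb R)$ with $0\le\widehat\varphi_0\le 1$, $\widehat\varphi_0(\xi)=1$ for $|\xi|\le 1$, $\widehat\varphi_0(\xi)=0$ for $|\xi|\ge \tfrac32$, $\widehat\varphi_1(\xi)=\widehat\varphi_0(\xi/2)-\widehat\varphi_0(\xi)$ and $\widehat\varphi_k(\xi)=\widehat\varphi_1(2^{-k+1}\xi)$ for $k\ge 2$. For a complex normed space $X$, let $\mathscr S'(\mathbb R;X)$ be the space of continuous linear maps $\mathscr S(\mathbb R)\to X$, and put $S_kf=\varphi_k*f$ for $f\in\mathscr S'(\mathbb R;X)$. For $s\in\mathbb R$, $p\in(1,\infty)$ and $q\in[1,\infty]$, the Triebel–Lizorkin space $F^s_{p,q}(\mathbb R;X)$ consists of all $f\in\mathscr S'(\mathbb R;X)$ with $\|(2^{sk}S_kf)_{k\ge0}\|_{L^p(\mathbb R;\ell^q(X))}<\infty$. For $t\in\mathbb R$, $r\in(1,\infty)$ and $z\in[1,\infty]$, the Besov space $B^t_{r,z}(\mathbb R)$ consists of all $f\in\mathscr S'(\mathbb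 R;\mathbb C)$ with $\|f\|_{B^t_{r,z}}=\|(2^{tk}S_kf)_{k\ge0}\|_{\ell^z(L^r(\mathbb R))}<\infty$, and carries this norm. Different choices from $\Phi(\mathbb R)$ give the same spaces with equivalent norms. Through the inclusions $B^t_{r,z}(\mathbb R)\subset\mathscr S'(\mathbb R;\mathbb C)$, the elements of the spaces $F^s_{p,q}(\mathbb R;B^t_{r,z}(\mathbb R))$ are regarded as linear maps $\mathscr S(\mathbb R)\to\mathscr S'(\mathbb R;\mathbb C)$. Let $s,t\in\mathbb R$, $\alpha,\beta>0$, $p,r\in(1,\infty)$, $1\le u<q\le\infty$ and $\theta\in[0,1]$. Then $$F^{s+\alpha}_{p,q}(\mathbb R;B^{t}_{r,1}(\mathbb R))\cap F^{s}_{p,q}(\mathbb R;B^{t+\beta}_{r,1}(\mathbb R))\nsubseteq F^{s+(1-\theta)\alpha}_{p,u}(\mathbb R;B^{t+\theta\beta}_{r,\infty}(\mathbb R)).$$ -/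

import Mathlib

open MeasureTheory SchwartzMap
open scoped ENNReal FourierTransform

/-- The class `Φ(ℝ)` of Littlewood-Paley sequences `(φ_k)_{k ≥ 0}`: the Fourier transform of the
generating function `φ 0` is `[0, 1]`-valued, equal to `1` for `|ξ| ≤ 1` and to `0` for
`|ξ| ≥ 3/2`, and the other members are obtained from it by differences and dyadic dilation. -/
structure IsLittlewoodPaley (φ : ℕ → 𝓢(ℝ, ℂ)) : Prop where
  mem_Icc : ∀ ξ : ℝ, ∃ a ∈ Set.Icc (0 : ℝ) 1, 𝓕 (φ 0) ξ = (a : ℂ)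
  eq_one : ∀ ξ : ℝ, |ξ| ≤ 1 → 𝓕 (φ 0) ξ = 1
  eq_zero : ∀ ξ : ℝ, 3 / 2 ≤ |ξ| → 𝓕 (φ 0) ξ = 0
  one : ∀ ξ : ℝ, 𝓕 (φ 1) ξ = 𝓕 (φ 0) (ξ / 2) - 𝓕 (φ 0) ξ
  dilate : ∀ k : ℕ, 2 ≤ k → ∀ ξ : ℝ, 𝓕 (φ k) ξ = 𝓕 (φ 1) (ξ / 2 ^ (k - 1))

/-- The Schwartz function `y ↦ g (x - y)`. -/
noncomputable def reflectTranslate (g : 𝓢(ℝ, ℂ)) (x : ℝ) : 𝓢(ℝ, ℂ) :=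
  compSubConstCLM ℂ x (compCLMOfContinuousLinearEquiv ℂ (ContinuousLinearEquiv.neg ℝ) g)

theorem reflectTranslate_apply (g : 𝓢(ℝ, ℂ)) (x y : ℝ) :
    reflectTranslate g x y = g (x - y) := by
  simp [reflectTranslate]

/-- The convolution `g * f` of a Schwartz function with an `X`-valued tempered distribution,
as the function `x ↦ f (g (x - ·))`. -/
noncomputable def distribConv {X : Type*} [AddCommGroup X] [Module ℂ X] [TopologicalSpace X]
    (g : 𝓢(ℝ, ℂ)) (f : 𝓢'(ℝ, X)) (x : ℝ) : X :=
  f (reflectTranslate g x)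

/-- The weighted Littlewood-Paley block `2 ^ (s k) S_k f = 2 ^ (s k) (φ_k * f)`, as a function. -/
noncomputable def lpBlock {X : Type*} [AddCommGroup X] [Module ℂ X] [TopologicalSpace X]
    (φ : ℕ → 𝓢(ℝ, ℂ)) (s : ℝ) (f : 𝓢'(ℝ, X)) (k : ℕ) (x : ℝ) : X :=
  (((2 : ℝ) ^ (s * (k : ℝ)) : ℝ) : ℂ) • distribConv (φ k) f x

theorem lpBlock_add {X : Type*} [AddCommGroup X] [Module ℂ X] [TopologicalSpace X]
    [IsTopologicalAddGroup X]
    (φ : ℕ → 𝓢(ℝ, ℂ)) (s : ℝ) (f g : 𝓢'(ℝ, X)) (k : ℕ) :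
    lpBlock φ s (f + g) k = lpBlock φ s f k + lpBlock φ s g k := by
  funext x
  simp only [lpBlock, distribConv, Pi.add_apply, ← smul_add]
  rfl

theorem lpBlock_smul {X : Type*} [AddCommGroup X] [Module ℂ X] [TopologicalSpace X]
    [IsTopologicalAddGroup X] [ContinuousConstSMul ℂ X]
    (φ : ℕ → 𝓢(ℝ, ℂ)) (s : ℝ) (c : ℂ) (f : 𝓢'(ℝ, X)) (k : ℕ) :
    lpBlock φ s (c • f) k = c • lpBlock φ s f k := by
  funext x
  simp only [lpBlock, distribConv, Pi.smul_apply]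
  rw [smul_comm c]
  rfl

theorem lpBlock_zero {X : Type*} [AddCommGroup X] [Module ℂ X] [TopologicalSpace X]
    [IsTopologicalAddGroup X]
    (φ : ℕ → 𝓢(ℝ, ℂ)) (s : ℝ) (k : ℕ) :
    lpBlock φ s (0 : 𝓢'(ℝ, X)) k = 0 := by
  funext x
  simp only [lpBlock, distribConv, Pi.zero_apply]
  exact smul_zero _

theorem toLp_lpBlock_add {ψ : ℕ → 𝓢(ℝ, ℂ)} {t : ℝ} {r : ℝ≥0∞} {f g : 𝓢'(ℝ, ℂ)} {k : ℕ}
    (h : MemLp (lpBlock ψ t (f + g) k) r volume)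
    (hf : MemLp (lpBlock ψ t f k) r volume) (hg : MemLp (lpBlock ψ t g k) r volume) :
    h.toLp = hf.toLp + hg.toLp := by
  simp only [lpBlock_add]
  rfl

theorem toLp_lpBlock_smul {ψ : ℕ → 𝓢(ℝ, ℂ)} {t : ℝ} {r : ℝ≥0∞} {c : ℂ} {f : 𝓢'(ℝ, ℂ)} {k : ℕ}
    (h : MemLp (lpBlock ψ t (c • f) k) r volume) (hf : MemLp (lpBlock ψ t f k) r volume) :
    h.toLp = c • hf.toLp := by
  simp only [lpBlock_smul]
  rfl

/-- The sequence `(2 ^ (t k) S_k f)_{k ≥ 0}` belongs to `ℓ^z(L^r(ℝ))`. -/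
def MemBesov (ψ : ℕ → 𝓢(ℝ, ℂ)) (t : ℝ) (r z : ℝ≥0∞) [Fact (1 ≤ r)] (f : 𝓢'(ℝ, ℂ)) : Prop :=
  ∃ h : ∀ k, MemLp (lpBlock ψ t f k) r volume,
    Memℓp (E := fun _ : ℕ => Lp ℂ r (volume : Measure ℝ)) (fun k => (h k).toLp) z

theorem MemBesov.add {ψ : ℕ → 𝓢(ℝ, ℂ)} {t : ℝ} {r z : ℝ≥0∞} [Fact (1 ≤ r)] {f g : 𝓢'(ℝ, ℂ)}
    (hf : MemBesov ψ t r z f) (hg : MemBesov ψ t r z g) : MemBesov ψ t r z (f + g) := by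
  obtain ⟨h₁, m₁⟩ := hf
  obtain ⟨h₂, m₂⟩ := hg
  refine ⟨fun k => ?_, ?_⟩
  · rw [lpBlock_add]
    exact (h₁ k).add (h₂ k)
  · convert m₁.add m₂ using 1
    exact funext fun k => toLp_lpBlock_add _ _ _

theorem MemBesov.smul {ψ : ℕ → 𝓢(ℝ, ℂ)} {t : ℝ} {r z : ℝ≥0∞} [Fact (1 ≤ r)] {f : 𝓢'(ℝ, ℂ)}
    (c : ℂ) (hf : MemBesov ψ t r z f) : MemBesov ψ t r z (c • f) := by
  obtain ⟨h₁, m₁⟩ := hf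
  refine ⟨fun k => ?_, ?_⟩
  · rw [lpBlock_smul]
    exact (h₁ k).const_smul c
  · convert m₁.const_smul c using 1
    exact funext fun k => toLp_lpBlock_smul _ _

theorem MemBesov.zero {ψ : ℕ → 𝓢(ℝ, ℂ)} {t : ℝ} {r z : ℝ≥0∞} [Fact (1 ≤ r)] :
    MemBesov ψ t r z 0 := by
  refine ⟨fun k => ?_, ?_⟩
  · rw [lpBlock_zero]
    exact MemLp.zero
  · convert zero_memℓp (E := fun _ : ℕ => Lp ℂ r (volume : Measure ℝ)) using 1
    funext k
    simp only [lpBlock_zero]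
    rfl

/-- The Besov space `B^t_{r,z}(ℝ)` as a linear subspace of `𝓢'(ℝ, ℂ)`. -/
def besovSubmodule (ψ : ℕ → 𝓢(ℝ, ℂ)) (t : ℝ) (r z : ℝ≥0∞) [Fact (1 ≤ r)] :
    Submodule ℂ 𝓢'(ℝ, ℂ) where
  carrier := {f | MemBesov ψ t r z f}
  add_mem' := MemBesov.add
  zero_mem' := MemBesov.zero
  smul_mem' := fun c _ hf => MemBesov.smul c hf

/-- The Besov space `B^t_{r,z}(ℝ)` as a type of its own, which carries the Besov norm and not the
topology of `𝓢'(ℝ, ℂ)`. -/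
def BesovSpace (ψ : ℕ → 𝓢(ℝ, ℂ)) (t : ℝ) (r z : ℝ≥0∞) [Fact (1 ≤ r)] : Type :=
  besovSubmodule ψ t r z

namespace BesovSpace

variable (ψ : ℕ → 𝓢(ℝ, ℂ)) (t : ℝ) (r z : ℝ≥0∞) [Fact (1 ≤ r)]

noncomputable instance instAddCommGroup : AddCommGroup (BesovSpace ψ t r z) :=
  inferInstanceAs (AddCommGroup (besovSubmodule ψ t r z))

noncomputable instance instModule : Module ℂ (BesovSpace ψ t r z) :=
  inferInstanceAs (Module ℂ (besovSubmodule ψ t r z))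

/-- The inclusion of `B^t_{r,z}(ℝ)` into `𝓢'(ℝ, ℂ)`. -/
noncomputable def incl : BesovSpace ψ t r z →ₗ[ℂ] 𝓢'(ℝ, ℂ) :=
  (besovSubmodule ψ t r z).subtype

/-- The map `f ↦ (2 ^ (t k) S_k f)_{k ≥ 0}` from `B^t_{r,z}(ℝ)` into `ℓ^z(L^r(ℝ))`. -/
noncomputable def blocks :
    BesovSpace ψ t r z →ₗ[ℂ] lp (fun _ : ℕ => Lp ℂ r (volume : Measure ℝ)) z where
  toFun f := ⟨fun k => (f.2.choose k).toLp, f.2.choose_spec⟩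
  map_add' f g := by
    exact Subtype.ext (funext fun k =>
      toLp_lpBlock_add ((f + g).2.choose k) (f.2.choose k) (g.2.choose k))
  map_smul' c f := by
    exact Subtype.ext (funext fun k =>
      toLp_lpBlock_smul ((c • f).2.choose k) (f.2.choose k))

/-- The Besov norm `‖f‖ = ‖(2 ^ (t k) S_k f)_{k ≥ 0}‖_{ℓ^z(L^r(ℝ))}`. -/
noncomputable instance instSeminormedAddCommGroup [Fact (1 ≤ z)] :
    SeminormedAddCommGroup (BesovSpace ψ t r z) :=
  SeminormedAddCommGroup.induced _ _ (blocks ψ t r z)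

noncomputable instance instNormedSpace [Fact (1 ≤ z)] : NormedSpace ℂ (BesovSpace ψ t r z) :=
  NormedSpace.induced ℂ _ _ (blocks ψ t r z)

end BesovSpace

/-- The quantity `‖(2 ^ (s k) S_k f)_{k ≥ 0}‖_{L^p(ℝ; ℓ^q(X))}`, possibly infinite; the `ℓ^q` norm
is the `L^q` norm for the counting measure on `ℕ`. -/
noncomputable def triebelLizorkinNorm {X : Type*} [SeminormedAddCommGroup X] [NormedSpace ℂ X]
    (φ : ℕ → 𝓢(ℝ, ℂ)) (s : ℝ) (p q : ℝ≥0∞) (f : 𝓢'(ℝ, X)) : ℝ≥0∞ :=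
  eLpNorm (fun x : ℝ => eLpNorm (fun k : ℕ => lpBlock φ s f k x) q Measure.count) p volume

/-- The Triebel-Lizorkin space `F^s_{p,q}(ℝ; X)`, a subset of `𝓢'(ℝ, X)`. -/
def TriebelLizorkin (φ : ℕ → 𝓢(ℝ, ℂ)) (s : ℝ) (p q : ℝ≥0∞) (X : Type*)
    [SeminormedAddCommGroup X] [NormedSpace ℂ X] : Set 𝓢'(ℝ, X) :=
  {f | triebelLizorkinNorm φ s p q f < ∞}

/-- The space `F^s_{p,q}(ℝ; B^t_{r,z}(ℝ))`, with its elements regarded as linear maps from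
`𝓢(ℝ, ℂ)` to `𝓢'(ℝ, ℂ)` through the inclusion of `B^t_{r,z}(ℝ)` into `𝓢'(ℝ, ℂ)`. In this way
spaces with different inner spaces become subsets of one and the same set. -/
def TriebelLizorkinBesov (φ ψ : ℕ → 𝓢(ℝ, ℂ)) (s : ℝ) (p q : ℝ≥0∞) (t : ℝ) (r z : ℝ≥0∞)
    [Fact (1 ≤ r)] [Fact (1 ≤ z)] : Set (𝓢(ℝ, ℂ) →ₗ[ℂ] 𝓢'(ℝ, ℂ)) :=
  {T | ∃ f ∈ TriebelLizorkin φ s p q (BesovSpace ψ t r z),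
    ∀ g : 𝓢(ℝ, ℂ), T g = BesovSpace.incl ψ t r z (f g)}

/-! ### Frequency intervals seen by exactly one Littlewood-Paley multiplier. -/

namespace IsLittlewoodPaley

variable {φ : ℕ → 𝓢(ℝ, ℂ)}

/-! The counterexample is a diagonal sum `T = ∑ A_j e_{m_j} ⊗ e'_{n_j}`. Here `e_m` and `e'_n` are
`φ 0` and `ψ 0` modulated to frequencies `7/8 * 2 ^ m` and `7/8 * 2 ^ n`, so that only block `m`,
respectively `n`, sees them (`modulation_reflectTranslate`). Both index sequences are injective, so
the outer block `m_j` retains a single inner modulation. Its Besov norm therefore does not depend on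
the third index, and at smoothness `(σ, τ)` the block has norm `2 ^ (σ m_j + τ n_j) A_j |φ 0 x| ‖ψ
0‖_r` (`norm_lpBlock_diagonalOperator`). Sharpening the inner index from `∞` to `1` thus gains
nothing.

The frequencies are chosen with `β n_j - α m_j` bounded (`exists_balanced_frequencies`), which makes
the weights at all points `(s + (1-θ)α, t + θβ)` comparable. Normalizing `A_j` reduces each norm, up
to constants, to the `ℓ^q` or `ℓ^u` norm of `a k = (k+1)^(-1/u)` along the `m_j`. This sequence lies
in `ℓ^q` for `q > u`, but not in `ℓ^u`, even on an arithmetic progression.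

Convergence of the sum and Besov-valued continuity come from the rapid decay of `𝓕⁻ g`, which
absorbs any power of `2 ^ m_j` (`exists_pow_mul_norm_modulation_le`). -/

theorem fourier_eq_sub (hφ : IsLittlewoodPaley φ) {k : ℕ} (hk : 1 ≤ k) (ξ : ℝ) :
    𝓕 (φ k) ξ = 𝓕 (φ 0) (ξ / 2 ^ k) - 𝓕 (φ 0) (ξ / 2 ^ (k - 1)) := by
  obtain rfl | hk := hk.eq_or_lt
  · simpa using hφ.one ξ
  · rw [hφ.dilate k hk, hφ.one]
    congr 2
    obtain ⟨j, rfl⟩ : ∃ j, k = j + 1 := ⟨k - 1, by omega⟩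
    rw [Nat.add_sub_cancel, pow_succ]
    field_simp

theorem fourier_eq_one (hφ : IsLittlewoodPaley φ) {k : ℕ} (hk : 1 ≤ k) {ξ : ℝ}
    (h₁ : 3 / 4 * 2 ^ k ≤ ξ) (h₂ : ξ ≤ 2 ^ k) : 𝓕 (φ k) ξ = 1 := by
  obtain ⟨j, rfl⟩ : ∃ j, k = j + 1 := ⟨k - 1, by omega⟩
  have h0 : (0 : ℝ) < 2 ^ j := by positivity
  have hξ : 0 ≤ ξ := le_trans (by positivity) h₁
  rw [hφ.fourier_eq_sub hk, hφ.eq_one, hφ.eq_zero, sub_zero]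
  · rw [Nat.add_sub_cancel, abs_of_nonneg (by positivity), le_div_iff₀ h0]
    rw [pow_succ] at h₁; linarith
  · rw [abs_of_nonneg (by positivity), div_le_one (by positivity)]
    exact h₂

/-- At such a `ξ` the value of `𝓕 (φ 0)` at `ξ / 2 ^ j`, as a function of `j`, jumps from 0 to 1
exactly at `j = k`. Every other consecutive difference vanishes. -/
theorem fourier_eq_zero (hφ : IsLittlewoodPaley φ) {k l : ℕ} (hlk : l ≠ k) {ξ : ℝ}
    (h₁ : 3 / 4 * 2 ^ k ≤ ξ) (h₂ : ξ ≤ 2 ^ k) : 𝓕 (φ l) ξ = 0 := by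
  have hξ : 0 ≤ ξ := le_trans (by positivity) h₁
  have small : ∀ j : ℕ, j < k → 𝓕 (φ 0) (ξ / 2 ^ j) = 0 := by
    intro j hj
    apply hφ.eq_zero
    rw [abs_of_nonneg (by positivity), le_div_iff₀ (by positivity)]
    have : (2 : ℝ) ^ (j + 1) ≤ 2 ^ k := pow_le_pow_right₀ (by norm_num) hj
    rw [pow_succ] at this
    linarith
  have large : ∀ j : ℕ, k ≤ j → 𝓕 (φ 0) (ξ / 2 ^ j) = 1 := by
    intro j hj
    apply hφ.eq_one
    rw [abs_of_nonneg (by positivity), div_le_one (by positivity)]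
    exact h₂.trans (pow_le_pow_right₀ (by norm_num) hj)
  rcases Nat.eq_zero_or_pos l with rfl | hl
  · simpa using small 0 (by omega)
  · rw [hφ.fourier_eq_sub hl]
    rcases lt_or_gt_of_ne hlk with h | h
    · rw [small l h, small (l - 1) (by omega), sub_zero]
    · rw [large l h.le, large (l - 1) (by omega), sub_self]

theorem ne_zero (hφ : IsLittlewoodPaley φ) : φ 0 ≠ 0 := by
  intro h
  have h1 := hφ.eq_one 0 (by simp)
  rw [h, FourierTransform.fourier_zero] at h1
  simp at h1

/-- If `𝓕 (φ 0)` is translated by `7/8 * 2 ^ n`, its support lies where only `𝓕 (φ n)` lives. -/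
theorem mem_Icc_of_fourier_sub_ne_zero (hφ : IsLittlewoodPaley φ) {n : ℕ} (hn : 4 ≤ n) {ξ : ℝ}
    (h : 𝓕 (φ 0) (ξ - 7 / 8 * 2 ^ n) ≠ 0) : 3 / 4 * 2 ^ n ≤ ξ ∧ ξ ≤ 2 ^ n := by
  have h1 : |ξ - 7 / 8 * 2 ^ n| < 3 / 2 := lt_of_not_ge fun h' => h (hφ.eq_zero _ h')
  -- `7/8 * 2 ^ n` is the midpoint of the interval, whose half-width `2 ^ n / 8` is at least 2,
  -- hence exceeds 3/2, once `n ≥ 4`.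
  have h2 : (2 : ℝ) ^ 4 ≤ 2 ^ n := pow_le_pow_right₀ (by norm_num) hn
  rw [abs_lt] at h1
  constructor <;> linarith

end IsLittlewoodPaley

/-! ### Modulated Schwartz functions as distributions. -/

theorem fourierInv_reflectTranslate (g : 𝓢(ℝ, ℂ)) (x ξ : ℝ) :
    𝓕⁻ (reflectTranslate g x) ξ = Real.fourierChar (x * ξ) • 𝓕 g ξ := by
  rw [SchwartzMap.fourierInv_coe, SchwartzMap.fourier_coe, Real.fourierInv_eq, Real.fourier_eq,
    Circle.smul_def, ← integral_smul]
  -- The substitution `v ↦ x - v` turns the inverse transform into the direct one and produces the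
  -- character.
  rw [← integral_sub_left_eq_self _ volume x]
  congr 1
  funext v
  rw [reflectTranslate_apply]
  simp only [sub_sub_cancel, RCLike.inner_apply, conj_trivial]
  rw [← Circle.smul_def, smul_smul, ← AddChar.map_add_eq_mul]
  congr 2
  ring

/-- The modulation of the Schwartz function `h` to the frequency `7/8 * 2 ^ n`, as a tempered
distribution, described on the Fourier side. -/
noncomputable def modulation (h : 𝓢(ℝ, ℂ)) (n : ℕ) : 𝓢(ℝ, ℂ) →L[ℂ] ℂ :=
  (integralCLM ℂ volume ∘L
    smulLeftCLM ℂ (compSubConstCLM ℂ (7 / 8 * 2 ^ n : ℝ) (𝓕 h) : 𝓢(ℝ, ℂ))) ∘L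
    FourierTransform.fourierInvCLM ℂ 𝓢(ℝ, ℂ)

theorem modulation_apply (h : 𝓢(ℝ, ℂ)) (n : ℕ) (g : 𝓢(ℝ, ℂ)) :
    modulation h n g = ∫ ξ, 𝓕 h (ξ - 7 / 8 * 2 ^ n) * 𝓕⁻ g ξ := by
  simp only [modulation, ContinuousLinearMap.comp_apply, integralCLM_apply]
  congr 1
  funext ξ
  rw [smulLeftCLM_apply_apply (SchwartzMap.hasTemperateGrowth _)]
  simp

/-- On the support of the translated `𝓕 (φ 0)` the multiplier `𝓕 (φ k)` is identically 1 or 0. In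
the first case Fourier inversion returns the modulated function, whose modulus `‖φ 0 x‖` does not
depend on `n`. -/
theorem modulation_reflectTranslate {φ : ℕ → 𝓢(ℝ, ℂ)} (hφ : IsLittlewoodPaley φ) {n : ℕ}
    (hn : 4 ≤ n) (k : ℕ) (x : ℝ) :
    modulation (φ 0) n (reflectTranslate (φ k) x) =
      if k = n then Real.fourierChar (x * (7 / 8 * 2 ^ n)) • φ 0 x else 0 := by
  rw [modulation_apply]
  split_ifs with hk
  · subst hk
    have h1 : ∀ ξ, 𝓕 (φ 0) (ξ - 7 / 8 * 2 ^ k) * 𝓕⁻ (reflectTranslate (φ k) x) ξ =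
        Real.fourierChar (x * ξ) • 𝓕 (φ 0) (ξ - 7 / 8 * 2 ^ k) := by
      intro ξ
      by_cases h0 : 𝓕 (φ 0) (ξ - 7 / 8 * 2 ^ k) = 0
      · simp [h0]
      · obtain ⟨h2, h3⟩ := hφ.mem_Icc_of_fourier_sub_ne_zero hn h0
        rw [fourierInv_reflectTranslate, hφ.fourier_eq_one (by omega) h2 h3, Circle.smul_def,
          Circle.smul_def, smul_eq_mul, smul_eq_mul, mul_one, mul_comm]
    simp_rw [h1]
    -- Recentring the frequency at 0 prepares Fourier inversion for `φ 0`.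
    rw [← integral_add_right_eq_self _ (7 / 8 * 2 ^ k : ℝ)]
    have h2 : φ 0 x = 𝓕⁻ (𝓕 (φ 0)) x := by rw [FourierTransform.fourierInv_fourier_eq]
    rw [h2, SchwartzMap.fourierInv_coe, Real.fourierInv_eq, Circle.smul_def, ← integral_smul]
    congr 1
    funext v
    rw [← Circle.smul_def, smul_smul, ← AddChar.map_add_eq_mul, add_sub_cancel_right]
    congr 2
    simp
    ring
  · rw [← integral_zero ℝ ℂ]
    congr 1
    funext ξ
    by_cases h0 : 𝓕 (φ 0) (ξ - 7 / 8 * 2 ^ n) = 0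
    · simp [h0]
    · obtain ⟨h2, h3⟩ := hφ.mem_Icc_of_fourier_sub_ne_zero hn h0
      rw [fourierInv_reflectTranslate, hφ.fourier_eq_zero hk h2 h3, smul_zero, mul_zero]

/-- The pairing only sees `𝓕⁻ g` at frequencies comparable to `2 ^ n`, where it decays faster than
any power. The bound is uniform in `n`, so coefficients growing polynomially in `2 ^ n` are
admissible. -/
theorem exists_pow_mul_norm_modulation_le {φ : ℕ → 𝓢(ℝ, ℂ)} (hφ : IsLittlewoodPaley φ) (M : ℕ) :
    ∃ (s : Finset (ℕ × ℕ)) (C : ℝ), 0 ≤ C ∧ ∀ n, 4 ≤ n → ∀ g : 𝓢(ℝ, ℂ),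
      (2 ^ n) ^ M * ‖modulation (φ 0) n g‖ ≤ C * s.sup (schwartzSeminormFamily ℂ ℝ ℂ) g := by
  have hcont : Continuous ((SchwartzMap.seminorm ℂ M 0).comp
      (FourierTransform.fourierInvCLM ℂ 𝓢(ℝ, ℂ)).toLinearMap) :=
    ((schwartz_withSeminorms ℂ ℝ ℂ).continuous_seminorm (M, 0)).comp
      (FourierTransform.fourierInvCLM ℂ 𝓢(ℝ, ℂ)).continuous
  obtain ⟨s, C, -, hC⟩ := Seminorm.bound_of_continuous (schwartz_withSeminorms ℂ ℝ ℂ) _ hcont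
  refine ⟨s, (∫ ξ, ‖𝓕 (φ 0) ξ‖) * 2 ^ M * C, by positivity, fun n hn g => ?_⟩
  have hb : SchwartzMap.seminorm ℂ M 0 (𝓕⁻ g) ≤
      C * s.sup (schwartzSeminormFamily ℂ ℝ ℂ) g := hC g
  have key : ∀ ξ, ‖(2 ^ n) ^ M * (𝓕 (φ 0) (ξ - 7 / 8 * 2 ^ n) * 𝓕⁻ g ξ)‖ ≤
      ‖𝓕 (φ 0) (ξ - 7 / 8 * 2 ^ n)‖ * (2 ^ M * SchwartzMap.seminorm ℂ M 0 (𝓕⁻ g)) := by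
    intro ξ
    by_cases h0 : 𝓕 (φ 0) (ξ - 7 / 8 * 2 ^ n) = 0
    · simp [h0]
    · obtain ⟨h2, h3⟩ := hφ.mem_Icc_of_fourier_sub_ne_zero hn h0
      have h4 : (0 : ℝ) < 2 ^ n := by positivity
      have h5 := SchwartzMap.norm_pow_mul_le_seminorm ℂ (𝓕⁻ g) M ξ
      rw [norm_mul, norm_mul, mul_left_comm]
      refine mul_le_mul_of_nonneg_left ?_ (norm_nonneg _)
      calc ‖((2 : ℂ) ^ n) ^ M‖ * ‖𝓕⁻ g ξ‖ = (2 ^ n) ^ M * ‖𝓕⁻ g ξ‖ := by simp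
        _ ≤ (2 * ‖ξ‖) ^ M * ‖𝓕⁻ g ξ‖ := by
          gcongr
          rw [Real.norm_eq_abs]
          linarith [le_abs_self ξ]
        _ = 2 ^ M * (‖ξ‖ ^ M * ‖𝓕⁻ g ξ‖) := by ring
        _ ≤ _ := by gcongr
  have hint : Integrable (fun ξ => ‖𝓕 (φ 0) (ξ - 7 / 8 * 2 ^ n)‖) :=
    ((𝓕 (φ 0)).integrable.comp_sub_right _).norm
  calc (2 ^ n) ^ M * ‖modulation (φ 0) n g‖
      = ‖∫ ξ, (2 ^ n) ^ M * (𝓕 (φ 0) (ξ - 7 / 8 * 2 ^ n) * 𝓕⁻ g ξ)‖ := by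
        rw [integral_const_mul, norm_mul, modulation_apply]
        simp
    _ ≤ ∫ ξ, ‖𝓕 (φ 0) (ξ - 7 / 8 * 2 ^ n)‖ * (2 ^ M * SchwartzMap.seminorm ℂ M 0 (𝓕⁻ g)) :=
        norm_integral_le_of_norm_le (hint.mul_const _) (.of_forall key)
    _ = (∫ ξ, ‖𝓕 (φ 0) ξ‖) * (2 ^ M * SchwartzMap.seminorm ℂ M 0 (𝓕⁻ g)) := by
        rw [integral_mul_const, integral_sub_right_eq_self (fun ξ => ‖𝓕 (φ 0) ξ‖)]
    _ ≤ (∫ ξ, ‖𝓕 (φ 0) ξ‖) * (2 ^ M * (C * s.sup (schwartzSeminormFamily ℂ ℝ ℂ) g)) := by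
        gcongr
    _ = _ := by ring

theorem exists_summable_mul_norm_modulation {φ : ℕ → 𝓢(ℝ, ℂ)} (hφ : IsLittlewoodPaley φ)
    {m : ℕ → ℕ} (hm : ∀ j, 4 ≤ m j) (hinj : m.Injective) {B : ℕ → ℝ} (hB : ∀ j, 0 ≤ B j)
    {K : ℝ} {M : ℕ} (hBK : ∀ j, B j ≤ K * (2 ^ m j) ^ M) :
    ∃ (s : Finset (ℕ × ℕ)) (C : ℝ), 0 ≤ C ∧ ∀ g : 𝓢(ℝ, ℂ),
      Summable (fun j => B j * ‖modulation (φ 0) (m j) g‖) ∧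
      ∑' j, B j * ‖modulation (φ 0) (m j) g‖ ≤ C * s.sup (schwartzSeminormFamily ℂ ℝ ℂ) g := by
  -- The spare power leaves a factor `2 ^ (-m j)`, summable because `m` is injective.
  obtain ⟨s, C, hC, h⟩ := exists_pow_mul_norm_modulation_le hφ (M + 1)
  have hK : 0 ≤ K := by
    have h1 := (hB 0).trans (hBK 0)
    exact nonneg_of_mul_nonneg_left h1 (by positivity)
  have hsum : Summable (fun j => ((1 : ℝ) / 2) ^ m j) :=
    summable_geometric_two.comp_injective hinj
  have hle : ∀ (g : 𝓢(ℝ, ℂ)) (j : ℕ), B j * ‖modulation (φ 0) (m j) g‖ ≤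
      (K * (C * s.sup (schwartzSeminormFamily ℂ ℝ ℂ) g)) * ((1 : ℝ) / 2) ^ m j := by
    intro g j
    have h2 : (2 : ℝ) ^ m j * (1 / 2) ^ m j = 1 := by
      rw [← mul_pow]; norm_num
    calc B j * ‖modulation (φ 0) (m j) g‖
        ≤ K * (2 ^ m j) ^ M * ‖modulation (φ 0) (m j) g‖ := by
          gcongr
          exact hBK j
      _ = K * ((2 ^ m j) ^ M * (2 ^ m j * (1 / 2) ^ m j) * ‖modulation (φ 0) (m j) g‖) := by
          rw [h2]; ring
      _ = K * ((2 ^ m j) ^ (M + 1) * ‖modulation (φ 0) (m j) g‖) * (1 / 2) ^ m j := by ring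
      _ ≤ _ := mul_le_mul_of_nonneg_right
          (mul_le_mul_of_nonneg_left (h _ (hm j) g) hK) (by positivity)
  refine ⟨s, K * C * ∑' j, ((1 : ℝ) / 2) ^ m j,
    mul_nonneg (mul_nonneg hK hC) (tsum_nonneg fun j => by positivity), fun g => ?_⟩
  have hs : Summable (fun j => B j * ‖modulation (φ 0) (m j) g‖) :=
    .of_nonneg_of_le (fun j => mul_nonneg (hB j) (norm_nonneg _)) (hle g) (hsum.mul_left _)
  refine ⟨hs, (hs.tsum_le_tsum (hle g) (hsum.mul_left _)).trans_eq ?_⟩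
  rw [tsum_mul_left]
  ring

/-! ### Besov norms of series of modulations. -/

section ModulationSeries

variable {ψ : ℕ → 𝓢(ℝ, ℂ)} {n : ℕ → ℕ} {b : ℕ → ℂ} {U : 𝓢'(ℝ, ℂ)}

theorem summable_mul_modulation (hψ : IsLittlewoodPaley ψ) (hn : ∀ j, 4 ≤ n j)
    (hb : Summable (fun j => ‖b j‖)) (v : 𝓢(ℝ, ℂ)) :
    Summable (fun j => ‖b j * modulation (ψ 0) (n j) v‖) := by
  obtain ⟨s, C, hC, h⟩ := exists_pow_mul_norm_modulation_le hψ 0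
  refine .of_nonneg_of_le (fun j => norm_nonneg _) (fun j => ?_)
    (hb.mul_right (C * s.sup (schwartzSeminormFamily ℂ ℝ ℂ) v))
  rw [norm_mul]
  gcongr
  simpa using h (n j) (hn j) v

theorem exists_eq_tsum_modulation (hψ : IsLittlewoodPaley ψ) (hn : ∀ j, 4 ≤ n j)
    (hb : Summable (fun j => ‖b j‖)) :
    ∃ U : 𝓢'(ℝ, ℂ), ∀ v, U v = ∑' j, b j * modulation (ψ 0) (n j) v := by
  have hs := summable_mul_modulation hψ hn hb
  refine ⟨ContinuousLinearMap.toPointwiseConvergenceCLM ℂ (RingHom.id ℂ) _ _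
    (SchwartzMap.mkCLMtoNormedSpace (𝕜 := ℂ) (𝕜' := ℂ) (σ := RingHom.id ℂ)
      (fun v => ∑' j, b j * modulation (ψ 0) (n j) v) ?_ ?_ ?_), fun v => rfl⟩
  · intro v w
    simp only [map_add, mul_add]
    exact (hs v).of_norm.tsum_add (hs w).of_norm
  · intro c v
    simp only [map_smul, smul_eq_mul, RingHom.id_apply, mul_left_comm _ c]
    exact tsum_mul_left
  · obtain ⟨s, C, hC, h⟩ := exists_pow_mul_norm_modulation_le hψ 0
    refine ⟨s, (∑' j, ‖b j‖) * C, by positivity, fun v => ?_⟩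
    calc ‖∑' j, b j * modulation (ψ 0) (n j) v‖
        ≤ ∑' j, ‖b j * modulation (ψ 0) (n j) v‖ := norm_tsum_le_tsum_norm (hs v)
      _ ≤ ∑' j, ‖b j‖ * (C * s.sup (schwartzSeminormFamily ℂ ℝ ℂ) v) := by
          refine (hs v).tsum_le_tsum (fun j => ?_) (hb.mul_right _)
          rw [norm_mul]
          gcongr
          simpa using h (n j) (hn j) v
      _ = _ := by rw [tsum_mul_right]; ring

variable (hψ : IsLittlewoodPaley ψ) (hn : ∀ j, 4 ≤ n j) (hinj : n.Injective)
  (hU : ∀ v, U v = ∑' j, b j * modulation (ψ 0) (n j) v)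

include hψ hn hinj hU

theorem lpBlock_modulationSeries (t : ℝ) (j : ℕ) :
    lpBlock ψ t U (n j) = fun y =>
      ((((2 : ℝ) ^ (t * (n j : ℝ)) : ℝ) : ℂ) * b j) •
        (Real.fourierChar (y * (7 / 8 * 2 ^ n j)) • ψ 0 y) := by
  funext y
  rw [lpBlock, distribConv, hU, tsum_eq_single j, modulation_reflectTranslate hψ (hn j), if_pos rfl,
    smul_eq_mul, smul_eq_mul, mul_assoc]
  intro i hi
  rw [modulation_reflectTranslate hψ (hn i), if_neg (fun h => hi (hinj h).symm), mul_zero]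

omit hinj in
theorem lpBlock_modulationSeries_of_notMem (t : ℝ) {k : ℕ} (hk : k ∉ Set.range n) :
    lpBlock ψ t U k = 0 := by
  funext y
  have : ∀ j, b j * modulation (ψ 0) (n j) (reflectTranslate (ψ k) y) = 0 := by
    intro j
    rw [modulation_reflectTranslate hψ (hn j), if_neg (fun h => hk ⟨j, h.symm⟩), mul_zero]
  simp [lpBlock, distribConv, hU, this]

theorem memLp_lpBlock_modulationSeries (t : ℝ) (r : ℝ≥0∞) (k : ℕ) :
    MemLp (lpBlock ψ t U k) r volume := by
  by_cases hk : k ∈ Set.range n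
  · obtain ⟨j, rfl⟩ := hk
    rw [lpBlock_modulationSeries hψ hn hinj hU]
    have h : MemLp (fun y => Real.fourierChar (y * (7 / 8 * 2 ^ n j)) • ψ 0 y) r volume := by
      refine MemLp.of_le ((ψ 0).memLp r volume) ?_ ?_
      · exact Continuous.aestronglyMeasurable
          ((Real.continuous_fourierChar.comp (by fun_prop)).smul (ψ 0).continuous)
      · exact .of_forall fun y => (Circle.norm_smul _ _).le
    exact MemLp.const_smul (𝕜 := ℂ) h _
  · rw [lpBlock_modulationSeries_of_notMem hψ hn hU t hk]
    exact MemLp.zero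

theorem norm_toLp_lpBlock_modulationSeries {t : ℝ} {r : ℝ≥0∞} {j : ℕ}
    (h : MemLp (lpBlock ψ t U (n j)) r volume) :
    ‖h.toLp‖ = 2 ^ (t * (n j : ℝ)) * ‖b j‖ * (eLpNorm (ψ 0) r volume).toReal := by
  rw [Lp.norm_toLp, lpBlock_modulationSeries hψ hn hinj hU]
  have h1 := eLpNorm_const_smul (μ := (volume : Measure ℝ)) (p := r)
    ((((2 : ℝ) ^ (t * (n j : ℝ)) : ℝ) : ℂ) * b j)
    (fun y => Real.fourierChar (y * (7 / 8 * 2 ^ n j)) • ψ 0 y)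
  rw [show (fun y => ((((2 : ℝ) ^ (t * (n j : ℝ)) : ℝ) : ℂ) * b j) •
        (Real.fourierChar (y * (7 / 8 * 2 ^ n j)) • ψ 0 y)) =
      ((((2 : ℝ) ^ (t * (n j : ℝ)) : ℝ) : ℂ) * b j) •
        (fun y => Real.fourierChar (y * (7 / 8 * 2 ^ n j)) • ψ 0 y) from rfl, h1,
    ENNReal.toReal_mul, toReal_enorm, norm_mul, Complex.norm_real, Real.norm_eq_abs,
    abs_of_pos (by positivity)]
  congr 2
  exact eLpNorm_congr_norm_ae (.of_forall fun y => Circle.norm_smul _ _)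

omit hinj in
theorem norm_toLp_lpBlock_modulationSeries_of_notMem {t : ℝ} {r : ℝ≥0∞} {k : ℕ}
    (hk : k ∉ Set.range n) (h : MemLp (lpBlock ψ t U k) r volume) : ‖h.toLp‖ = 0 := by
  rw [Lp.norm_toLp, lpBlock_modulationSeries_of_notMem hψ hn hU t hk]
  simp

theorem memBesov_modulationSeries {t : ℝ} {r : ℝ≥0∞} [Fact (1 ≤ r)]
    (hs : Summable (fun j => 2 ^ (t * (n j : ℝ)) * ‖b j‖)) : MemBesov ψ t r 1 U := by
  have hL := memLp_lpBlock_modulationSeries hψ hn hinj hU t r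
  refine ⟨hL, memℓp_gen ?_⟩
  simp only [ENNReal.toReal_one, Real.rpow_one]
  rw [← hinj.summable_iff
    (fun k hk => norm_toLp_lpBlock_modulationSeries_of_notMem hψ hn hU hk (hL k))]
  refine (hs.mul_right (eLpNorm (ψ 0) r volume).toReal).congr fun j => ?_
  exact (norm_toLp_lpBlock_modulationSeries hψ hn hinj hU (hL (n j))).symm

theorem BesovSpace.norm_modulationSeries {t : ℝ} {r : ℝ≥0∞} [Fact (1 ≤ r)]
    (x : BesovSpace ψ t r 1) (hx : BesovSpace.incl ψ t r 1 x = U) :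
    ‖x‖ = (∑' j, 2 ^ (t * (n j : ℝ)) * ‖b j‖) * (eLpNorm (ψ 0) r volume).toReal := by
  subst hx
  have hL : ∀ k, MemLp (lpBlock ψ t (BesovSpace.incl ψ t r 1 x) k) r volume := x.2.choose
  have h1 : ‖x‖ = ‖BesovSpace.blocks ψ t r 1 x‖ := rfl
  rw [h1, lp.norm_eq_tsum_rpow (by simp)]
  simp only [ENNReal.toReal_one, Real.rpow_one, div_one]
  have h2 : ∀ k, ‖BesovSpace.blocks ψ t r 1 x k‖ = ‖(hL k).toLp‖ := fun k => rfl
  simp only [h2]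
  rw [← hinj.tsum_eq, ← tsum_mul_right]
  · exact tsum_congr fun j => norm_toLp_lpBlock_modulationSeries hψ hn hinj hU (hL (n j))
  · intro k hk
    by_contra hk'
    exact hk (norm_toLp_lpBlock_modulationSeries_of_notMem hψ hn hU hk' (hL k))

/-- With one nonzero block the `ℓ^z` norm is the same for every `z`. This allows `z = 1` in the
hypotheses and `z = ∞` in the conclusion of the main theorem to be treated alike. -/
theorem BesovSpace.norm_modulationSeries_single {t : ℝ} {r z : ℝ≥0∞} [Fact (1 ≤ r)] [Fact (1 ≤ z)]
    (x : BesovSpace ψ t r z) (hx : BesovSpace.incl ψ t r z x = U) {j : ℕ}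
    (hb : ∀ i, i ≠ j → b i = 0) :
    ‖x‖ = 2 ^ (t * (n j : ℝ)) * ‖b j‖ * (eLpNorm (ψ 0) r volume).toReal := by
  subst hx
  have hL : ∀ k, MemLp (lpBlock ψ t (BesovSpace.incl ψ t r z x) k) r volume := x.2.choose
  have h2 : ∀ k, BesovSpace.blocks ψ t r z x k = (hL k).toLp := fun k => rfl
  have h3 : BesovSpace.blocks ψ t r z x = lp.single z (n j) (hL (n j)).toLp := by
    ext1
    funext k
    rw [h2, lp.single_apply]
    by_cases hk : k = n j
    · subst hk
      rw [Pi.single_eq_same]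
    · rw [Pi.single_eq_of_ne hk, ← norm_eq_zero]
      by_cases hk' : k ∈ Set.range n
      · obtain ⟨i, rfl⟩ := hk'
        rw [norm_toLp_lpBlock_modulationSeries hψ hn hinj hU (hL (n i)),
          hb i (fun h => hk (by rw [h]))]
        simp
      · exact norm_toLp_lpBlock_modulationSeries_of_notMem hψ hn hU hk' (hL k)
  have h1 : ‖x‖ = ‖BesovSpace.blocks ψ t r z x‖ := rfl
  rw [h1, h3, lp.norm_single (zero_lt_one.trans_le Fact.out)]
  exact norm_toLp_lpBlock_modulationSeries hψ hn hinj hU (hL (n j))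

end ModulationSeries

/-! ### The diagonal operator and its Littlewood-Paley blocks. -/

section DiagonalOperator

variable {φ ψ : ℕ → 𝓢(ℝ, ℂ)} {m n : ℕ → ℕ} {A : ℕ → ℝ}

theorem exists_diagonalOperator (hφ : IsLittlewoodPaley φ) (hψ : IsLittlewoodPaley ψ)
    (hm : ∀ j, 4 ≤ m j) (hn : ∀ j, 4 ≤ n j) (hinj : m.Injective) (hA : ∀ j, 0 ≤ A j)
    {K : ℝ} {M : ℕ} (hAK : ∀ j, A j ≤ K * (2 ^ m j) ^ M) :
    ∃ T : 𝓢(ℝ, ℂ) →ₗ[ℂ] 𝓢'(ℝ, ℂ), ∀ g v, T g v =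
      ∑' j, ((A j : ℂ) * modulation (φ 0) (m j) g) * modulation (ψ 0) (n j) v := by
  obtain ⟨_, _, _, h⟩ := exists_summable_mul_norm_modulation hφ hm hinj hA hAK
  have hb : ∀ g : 𝓢(ℝ, ℂ), Summable (fun j => ‖(A j : ℂ) * modulation (φ 0) (m j) g‖) := by
    intro g
    refine (h g).1.congr fun j => ?_
    rw [norm_mul, Complex.norm_real, Real.norm_eq_abs, abs_of_nonneg (hA j)]
  choose T hT using fun g => exists_eq_tsum_modulation hψ hn (hb g)
  refine ⟨{ toFun := T, map_add' := fun g₁ g₂ => ?_, map_smul' := fun c g => ?_ }, hT⟩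
  · refine UniformConvergenceCLM.ext _ _ fun v => ?_
    change T (g₁ + g₂) v = T g₁ v + T g₂ v
    simp only [hT, map_add, mul_add, add_mul]
    exact (summable_mul_modulation hψ hn (hb g₁) v).of_norm.tsum_add
      (summable_mul_modulation hψ hn (hb g₂) v).of_norm
  · refine UniformConvergenceCLM.ext _ _ fun v => ?_
    change T (c • g) v = c * T g v
    simp only [hT, map_smul, smul_eq_mul]
    rw [← tsum_mul_left]
    exact tsum_congr fun j => by ring

variable {T : 𝓢(ℝ, ℂ) →ₗ[ℂ] 𝓢'(ℝ, ℂ)}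

/-- For `z = 1` the Besov norm of `T g` is a weighted sum of the `‖modulation (φ 0) (m j) g‖`. Their
decay bounds it by a Schwartz seminorm of `g`, which gives both membership and continuity for the
Besov norm. -/
theorem exists_besov_valued_diagonalOperator (hφ : IsLittlewoodPaley φ) (hψ : IsLittlewoodPaley ψ)
    (hm : ∀ j, 4 ≤ m j) (hn : ∀ j, 4 ≤ n j) (hminj : m.Injective) (hninj : n.Injective)
    (hA : ∀ j, 0 ≤ A j)
    (hT : ∀ g v, T g v =
      ∑' j, ((A j : ℂ) * modulation (φ 0) (m j) g) * modulation (ψ 0) (n j) v)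
    {t : ℝ} (r : ℝ≥0∞) [Fact (1 ≤ r)]
    {K : ℝ} {M : ℕ} (hAK : ∀ j, 2 ^ (t * (n j : ℝ)) * A j ≤ K * (2 ^ m j) ^ M) :
    ∃ f : 𝓢'(ℝ, BesovSpace ψ t r 1), ∀ g, T g = BesovSpace.incl ψ t r 1 (f g) := by
  obtain ⟨s, C, hC, h⟩ := exists_summable_mul_norm_modulation hφ hm hminj
    (fun j => mul_nonneg (by positivity) (hA j)) hAK
  have hnorm : ∀ (g : 𝓢(ℝ, ℂ)) (j : ℕ),
      2 ^ (t * (n j : ℝ)) * ‖(A j : ℂ) * modulation (φ 0) (m j) g‖ =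
        2 ^ (t * (n j : ℝ)) * A j * ‖modulation (φ 0) (m j) g‖ := by
    intro g j
    rw [norm_mul, Complex.norm_real, Real.norm_eq_abs, abs_of_nonneg (hA j), mul_assoc]
  have hmem : ∀ g, MemBesov ψ t r 1 (T g) := fun g =>
    memBesov_modulationSeries hψ hn hninj (hT g) ((h g).1.congr fun j => (hnorm g j).symm)
  let F : 𝓢(ℝ, ℂ) →ₗ[ℂ] BesovSpace ψ t r 1 :=
    { toFun := fun g => ⟨T g, hmem g⟩
      map_add' := fun g₁ g₂ => Subtype.ext (map_add T g₁ g₂)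
      map_smul' := fun c g => Subtype.ext (map_smul T c g) }
  have hF : ∀ g, ‖F g‖ ≤ C * (eLpNorm (ψ 0) r volume).toReal *
      s.sup (schwartzSeminormFamily ℂ ℝ ℂ) g := by
    intro g
    rw [BesovSpace.norm_modulationSeries hψ hn hninj (hT g) (F g) rfl,
      tsum_congr (hnorm g), mul_right_comm]
    exact mul_le_mul_of_nonneg_right (h g).2 ENNReal.toReal_nonneg
  have hcont : Continuous F := by
    apply WithSeminorms.continuous_normedSpace_rng _ (schwartz_withSeminorms ℂ ℝ ℂ)
    exact ⟨s, ⟨C * (eLpNorm (ψ 0) r volume).toReal, by positivity⟩, hF⟩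
  exact ⟨ContinuousLinearMap.toPointwiseConvergenceCLM ℂ (RingHom.id ℂ) _ _ ⟨F, hcont⟩,
    fun g => rfl⟩

variable {t σ : ℝ} {r z : ℝ≥0∞} [Fact (1 ≤ r)] [Fact (1 ≤ z)]

/-- Testing against `φ (m j)` annihilates every coefficient except the `j`-th, so the one-block
Besov formula applies. Since `f` is any representative of `T`, the identity also holds for one whose
existence is merely assumed. -/
theorem norm_lpBlock_diagonalOperator (hφ : IsLittlewoodPaley φ) (hψ : IsLittlewoodPaley ψ)
    (hm : ∀ j, 4 ≤ m j) (hn : ∀ j, 4 ≤ n j) (hminj : m.Injective) (hninj : n.Injective)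
    (hA : ∀ j, 0 ≤ A j)
    (hT : ∀ g v, T g v =
      ∑' j, ((A j : ℂ) * modulation (φ 0) (m j) g) * modulation (ψ 0) (n j) v)
    {f : 𝓢'(ℝ, BesovSpace ψ t r z)} (hf : ∀ g, T g = BesovSpace.incl ψ t r z (f g))
    (j : ℕ) (x : ℝ) :
    ‖lpBlock φ σ f (m j) x‖ = 2 ^ (σ * (m j : ℝ)) * (2 ^ (t * (n j : ℝ)) * A j) *
      (‖φ 0 x‖ * (eLpNorm (ψ 0) r volume).toReal) := by
  rw [lpBlock, norm_smul, Complex.norm_real, Real.norm_eq_abs, abs_of_pos (by positivity),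
    distribConv, BesovSpace.norm_modulationSeries_single hψ hn hninj (hT _) _ (hf _).symm (j := j),
    modulation_reflectTranslate hφ (hm j), if_pos rfl, norm_mul, Circle.norm_smul,
    Complex.norm_real, Real.norm_eq_abs, abs_of_nonneg (hA j)]
  · ring
  · intro i hi
    rw [modulation_reflectTranslate hφ (hm i), if_neg (fun h => hi (hminj h).symm), mul_zero]

theorem norm_lpBlock_diagonalOperator_of_notMem (hφ : IsLittlewoodPaley φ)
    (hψ : IsLittlewoodPaley ψ)
    (hm : ∀ j, 4 ≤ m j) (hn : ∀ j, 4 ≤ n j) (hninj : n.Injective)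
    (hT : ∀ g v, T g v =
      ∑' j, ((A j : ℂ) * modulation (φ 0) (m j) g) * modulation (ψ 0) (n j) v)
    {f : 𝓢'(ℝ, BesovSpace ψ t r z)} (hf : ∀ g, T g = BesovSpace.incl ψ t r z (f g))
    {k : ℕ} (hk : k ∉ Set.range m) (x : ℝ) :
    ‖lpBlock φ σ f k x‖ = 0 := by
  have h : ∀ i, modulation (φ 0) (m i) (reflectTranslate (φ k) x) = 0 := fun i => by
    rw [modulation_reflectTranslate hφ (hm i), if_neg (fun h => hk ⟨i, h.symm⟩)]
  -- All coefficients vanish here, so the index 0 is an arbitrary choice.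
  rw [lpBlock, norm_smul, distribConv,
    BesovSpace.norm_modulationSeries_single hψ hn hninj (hT _) _ (hf _).symm (j := 0), h]
  · simp
  · intro i _
    rw [h, mul_zero]

end DiagonalOperator

/-! ### Mixed norms of functions comparable to a product. -/

section MixedNorm

variable {X : Type*} [SeminormedAddCommGroup X]

theorem eLpNorm_eLpNorm_count_lt_top {p q : ℝ≥0∞} {h : 𝓢(ℝ, ℂ)} {a : ℕ → ℝ} {c : ℝ}
    (ha : eLpNorm a q Measure.count < ∞) {G : ℕ → ℝ → X}
    (hG : ∀ k x, ‖G k x‖ ≤ c * ‖h x‖ * ‖a k‖) :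
    eLpNorm (fun x => eLpNorm (fun k => G k x) q Measure.count) p (volume : Measure ℝ) < ∞ := by
  have hle : ∀ x, eLpNorm (fun k => G k x) q Measure.count ≤
      ‖(c * (eLpNorm a q Measure.count).toReal) * ‖h x‖‖ₑ := by
    intro x
    calc eLpNorm (fun k => G k x) q Measure.count
        ≤ eLpNorm ((c * ‖h x‖) • a) q Measure.count := by
          refine eLpNorm_mono_enorm fun k => ?_
          rw [enorm_le_iff_norm_le, Pi.smul_apply, norm_smul]
          refine (hG k x).trans ?_
          exact mul_le_mul_of_nonneg_right (le_abs_self _) (norm_nonneg _)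
      _ = ‖c * ‖h x‖‖ₑ * eLpNorm a q Measure.count := eLpNorm_const_smul _ _ _ _
      _ = _ := by
          conv_lhs => rw [← ENNReal.ofReal_toReal ha.ne,
            ← Real.enorm_of_nonneg ENNReal.toReal_nonneg, ← enorm_mul]
          ring_nf
  refine (eLpNorm_mono_enorm (g := fun x => (c * (eLpNorm a q Measure.count).toReal) * ‖h x‖)
    fun x => ?_).trans_lt ((h.memLp p volume).norm.const_mul _).eLpNorm_lt_top
  exact hle x

theorem eLpNorm_eLpNorm_count_eq_top {p q : ℝ≥0∞} (hp : p ≠ 0) (hp' : p ≠ ∞)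
    {h : 𝓢(ℝ, ℂ)} (hh : h ≠ 0)
    {a : ℕ → ℝ} {c : ℝ} (hc : 0 < c)
    (ha : eLpNorm a q Measure.count = ∞) {G : ℕ → ℝ → X}
    (hG : ∀ k x, c * ‖h x‖ * ‖a k‖ ≤ ‖G k x‖) :
    eLpNorm (fun x => eLpNorm (fun k => G k x) q Measure.count) p (volume : Measure ℝ) = ∞ := by
  have htop : ∀ x, h x ≠ 0 → eLpNorm (fun k => G k x) q Measure.count = ∞ := by
    intro x hx
    have hle : eLpNorm ((c * ‖h x‖) • a) q Measure.count ≤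
        eLpNorm (fun k => G k x) q Measure.count := by
      refine eLpNorm_mono_enorm fun k => ?_
      rw [enorm_le_iff_norm_le, Pi.smul_apply, norm_smul,
        Real.norm_of_nonneg (by positivity)]
      exact hG k x
    rw [eLpNorm_const_smul, ha, ENNReal.mul_top (by simp [hc.ne', hx])] at hle
    exact top_le_iff.mp hle
  obtain ⟨x₀, hx₀⟩ : ∃ x, h x ≠ 0 := by
    by_contra! H
    exact hh (SchwartzMap.ext H)
  have hpos : (volume : Measure ℝ) {x | h x ≠ 0} ≠ 0 :=
    ((isOpen_ne_fun h.continuous continuous_const).measure_pos volume ⟨x₀, hx₀⟩).ne'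
  have hmeas : MeasurableSet {x | h x ≠ 0} :=
    (isOpen_ne_fun h.continuous continuous_const).measurableSet
  -- The inner norm is infinite on the nonempty open set `{h ≠ 0}`. Comparison with an `∞`-valued
  -- indicator is pointwise and needs no measurability of the inner norm in `x`.
  have hind : eLpNorm ({x | h x ≠ 0}.indicator fun _ => (∞ : ℝ≥0∞)) p (volume : Measure ℝ) = ∞ := by
    rw [eLpNorm_indicator_const₀ hmeas.nullMeasurableSet hp hp', enorm_eq_self, ENNReal.top_mul]
    rw [Ne, ENNReal.rpow_eq_zero_iff, not_or]
    exact ⟨fun h => hpos h.1, fun h => not_lt_of_ge (by positivity) h.2⟩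
  rw [← top_le_iff, ← hind]
  refine eLpNorm_mono_enorm fun x => ?_
  by_cases hx : h x = 0
  · simp [hx]
  · simp [hx, htop x hx]

end MixedNorm

/-! ### A sequence in `ℓ^q` but not in `ℓ^u`, even along arithmetic progressions. -/

theorem eLpNorm_rpow_count_lt_top {u q : ℝ≥0∞} (hu : 1 ≤ u) (huq : u < q) :
    eLpNorm (fun k : ℕ => ((k : ℝ) + 1) ^ (-(1 / u.toReal))) q Measure.count < ∞ := by
  have hu0 : 0 < u.toReal :=
    ENNReal.toReal_pos (zero_lt_one.trans_le hu).ne' (huq.trans_le le_top).ne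
  by_cases hq : q = ∞
  · subst hq
    rw [eLpNorm_exponent_top, eLpNormEssSup_count]
    refine lt_of_le_of_lt (iSup_le fun k => ?_) ENNReal.one_lt_top
    rw [Real.enorm_of_nonneg (by positivity), ENNReal.ofReal_le_one]
    exact Real.rpow_le_one_of_one_le_of_nonpos (by linarith [Nat.cast_nonneg (α := ℝ) k])
      (by simp [hu0.le])
  · have hq0 : q ≠ 0 := (bot_le.trans_lt huq).ne'
    rw [eLpNorm_lt_top_iff_lintegral_rpow_enorm_lt_top hq0 hq, lintegral_count]
    have huq' : u.toReal < q.toReal := (ENNReal.toReal_lt_toReal (huq.trans_le le_top).ne hq).2 huq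
    have hsum : Summable (fun k : ℕ => ((k : ℝ) + 1) ^ (-(q.toReal / u.toReal))) := by
      have h1 : Summable (fun k : ℕ => (k : ℝ) ^ (-(q.toReal / u.toReal))) := by
        rw [Real.summable_nat_rpow]
        have : 1 < q.toReal / u.toReal := by rwa [one_lt_div hu0]
        linarith
      simpa using (summable_nat_add_iff 1).2 h1
    have heq : ∀ k : ℕ, ‖((k : ℝ) + 1) ^ (-(1 / u.toReal))‖ₑ ^ q.toReal =
        ENNReal.ofReal (((k : ℝ) + 1) ^ (-(q.toReal / u.toReal))) := by
      intro k
      rw [Real.enorm_of_nonneg (by positivity), ENNReal.ofReal_rpow_of_nonneg (by positivity)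
        ENNReal.toReal_nonneg, ← Real.rpow_mul (by positivity)]
      congr 2
      ring
    simp_rw [heq]
    exact hsum.tsum_ofReal_lt_top

theorem eLpNorm_indicator_rpow_count_eq_top {u : ℝ≥0∞} (hu : 1 ≤ u) (hu' : u < ∞) {N c : ℕ}
    (hN : 1 ≤ N) :
    eLpNorm ((Set.range fun j => N * j + c).indicator
      fun k : ℕ => ((k : ℝ) + 1) ^ (-(1 / u.toReal))) u Measure.count = ∞ := by
  have hu1 : u ≠ 0 := (zero_lt_one.trans_le hu).ne'
  have hu0 : 0 < u.toReal := ENNReal.toReal_pos hu1 hu'.ne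
  by_contra hne
  have hlt := lt_top_iff_ne_top.2 hne
  rw [eLpNorm_lt_top_iff_lintegral_rpow_enorm_lt_top hu1 hu'.ne, lintegral_count] at hlt
  have hinj : Function.Injective (fun j => N * j + c) := fun i j h => by
    simpa [Nat.pos_iff_ne_zero.1 hN] using h
  have h1 := (ENNReal.tsum_comp_le_tsum_of_injective hinj _).trans_lt hlt
  have heq : ∀ j : ℕ, (‖(Set.range fun j => N * j + c).indicator
      (fun k : ℕ => ((k : ℝ) + 1) ^ (-(1 / u.toReal))) (N * j + c)‖ₑ ^ u.toReal).toReal =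
        1 / ((N * j + c : ℕ) + 1) := by
    intro j
    rw [Set.indicator_of_mem (Set.mem_range_self j), ← ENNReal.toReal_rpow, toReal_enorm,
      Real.norm_of_nonneg (by positivity), ← Real.rpow_mul (by positivity)]
    rw [show -(1 / u.toReal) * u.toReal = -1 by field_simp, Real.rpow_neg_one, one_div]
  have h2 := (ENNReal.summable_toReal h1.ne).congr heq
  have h3 : Summable (fun j : ℕ => 1 / ((j : ℝ) + 1)) := by
    -- The constant comes from `N j + c + 1 ≤ (N + c + 1)(j + 1)`, which reduces the claim to
    -- divergence of the harmonic series.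
    refine .of_nonneg_of_le (fun j => by positivity) (fun j => ?_) (h2.mul_left ((N : ℝ) + c + 1))
    rw [mul_one_div, div_le_div_iff₀ (by positivity) (by positivity)]
    have : 0 ≤ (c : ℝ) * j + j + N := by positivity
    push_cast
    nlinarith
  have h4 : Summable (fun j : ℕ => 1 / (j : ℝ)) :=
    (summable_nat_add_iff 1).1 (by simpa using h3)
  exact Real.not_summable_one_div_natCast h4

/-! ### Triebel-Lizorkin norms of the diagonal operator, and the counterexample. -/

theorem triebelLizorkinNorm_diagonalOperator_lt_top {φ ψ : ℕ → 𝓢(ℝ, ℂ)} {m n : ℕ → ℕ} {A : ℕ → ℝ}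
    {T : 𝓢(ℝ, ℂ) →ₗ[ℂ] 𝓢'(ℝ, ℂ)} {t σ : ℝ} {r z : ℝ≥0∞} [Fact (1 ≤ r)] [Fact (1 ≤ z)]
    (hφ : IsLittlewoodPaley φ) (hψ : IsLittlewoodPaley ψ)
    (hm : ∀ j, 4 ≤ m j) (hn : ∀ j, 4 ≤ n j) (hminj : m.Injective) (hninj : n.Injective)
    (hA : ∀ j, 0 ≤ A j)
    (hT : ∀ g v, T g v =
      ∑' j, ((A j : ℂ) * modulation (φ 0) (m j) g) * modulation (ψ 0) (n j) v)
    {f : 𝓢'(ℝ, BesovSpace ψ t r z)} (hf : ∀ g, T g = BesovSpace.incl ψ t r z (f g))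
    {p q : ℝ≥0∞} {a : ℕ → ℝ} (ha : eLpNorm a q Measure.count < ∞) {c : ℝ} (hc : 0 ≤ c)
    (hle : ∀ j, 2 ^ (σ * (m j : ℝ)) * (2 ^ (t * (n j : ℝ)) * A j) ≤ c * ‖a (m j)‖) :
    triebelLizorkinNorm φ σ p q f < ∞ := by
  refine eLpNorm_eLpNorm_count_lt_top (h := φ 0) (a := a)
    (c := c * (eLpNorm (ψ 0) r volume).toReal) ha (G := fun k x => lpBlock φ σ f k x) ?_
  intro k x
  by_cases hk : k ∈ Set.range m
  · obtain ⟨j, rfl⟩ := hk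
    rw [norm_lpBlock_diagonalOperator hφ hψ hm hn hminj hninj hA hT hf]
    calc _ ≤ c * ‖a (m j)‖ * (‖φ 0 x‖ * (eLpNorm (ψ 0) r volume).toReal) :=
          mul_le_mul_of_nonneg_right (hle j) (by positivity)
      _ = _ := by ring
  · rw [norm_lpBlock_diagonalOperator_of_notMem hφ hψ hm hn hninj hT hf hk]
    positivity

theorem triebelLizorkinNorm_diagonalOperator_eq_top {φ ψ : ℕ → 𝓢(ℝ, ℂ)} {m n : ℕ → ℕ} {A : ℕ → ℝ}
    {T : 𝓢(ℝ, ℂ) →ₗ[ℂ] 𝓢'(ℝ, ℂ)} {t σ : ℝ} {r z : ℝ≥0∞} [Fact (1 ≤ r)] [Fact (1 ≤ z)]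
    (hφ : IsLittlewoodPaley φ) (hψ : IsLittlewoodPaley ψ)
    (hm : ∀ j, 4 ≤ m j) (hn : ∀ j, 4 ≤ n j) (hminj : m.Injective) (hninj : n.Injective)
    (hA : ∀ j, 0 ≤ A j)
    (hT : ∀ g v, T g v =
      ∑' j, ((A j : ℂ) * modulation (φ 0) (m j) g) * modulation (ψ 0) (n j) v)
    {f : 𝓢'(ℝ, BesovSpace ψ t r z)} (hf : ∀ g, T g = BesovSpace.incl ψ t r z (f g))
    {p q : ℝ≥0∞} (hp : p ≠ 0) (hp' : p ≠ ∞) {a : ℕ → ℝ}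
    (ha : eLpNorm ((Set.range m).indicator a) q Measure.count = ∞) {c : ℝ} (hc : 0 < c)
    (hle : ∀ j, c * ‖a (m j)‖ ≤ 2 ^ (σ * (m j : ℝ)) * (2 ^ (t * (n j : ℝ)) * A j)) :
    triebelLizorkinNorm φ σ p q f = ∞ := by
  have hR : 0 < (eLpNorm (ψ 0) r volume).toReal := by
    refine ENNReal.toReal_pos ?_ ((ψ 0).memLp r volume).eLpNorm_ne_top
    rw [Ne, eLpNorm_eq_zero_iff (ψ 0).continuous.aestronglyMeasurable
      (zero_lt_one.trans_le (Fact.out : 1 ≤ r)).ne',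
      (ψ 0).continuous.ae_eq_iff_eq volume continuous_zero]
    exact fun h => hψ.ne_zero (SchwartzMap.ext (congrFun h))
  refine eLpNorm_eLpNorm_count_eq_top hp hp' hφ.ne_zero (mul_pos hc hR) ha
    (G := fun k x => lpBlock φ σ f k x) ?_
  intro k x
  by_cases hk : k ∈ Set.range m
  · rw [Set.indicator_of_mem hk]
    obtain ⟨j, rfl⟩ := hk
    rw [norm_lpBlock_diagonalOperator hφ hψ hm hn hminj hninj hA hT hf]
    calc _ = c * ‖a (m j)‖ * (‖φ 0 x‖ * (eLpNorm (ψ 0) r volume).toReal) := by ring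
      _ ≤ _ := mul_le_mul_of_nonneg_right (hle j) (by positivity)
  · rw [Set.indicator_of_notMem hk]
    simp

/-- Arithmetic progressions `m` and sequences `n` with `α m - β n` bounded. -/
theorem exists_balanced_frequencies {α β : ℝ} (hα : 0 < α) (hβ : 0 < β) :
    ∃ (N : ℕ) (n : ℕ → ℕ) (D : ℝ), 1 ≤ N ∧ (∀ j, 4 ≤ n j) ∧ n.Injective ∧ 0 ≤ D ∧
      ∀ j, |β * n j - α * (N * j + 4 : ℕ)| ≤ D := by
  -- The step `N ≥ β / α` makes `α N j / β` grow by at least 1 with each `j`, so its floors are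
  -- strictly increasing.
  obtain ⟨N, hN⟩ := exists_nat_ge (β / α + 1)
  have hN1 : (1 : ℝ) ≤ N := le_trans (by linarith [div_pos hβ hα]) hN
  have hNβ : β ≤ α * N := by
    have : β / α ≤ N := by linarith
    rw [div_le_iff₀ hα] at this
    linarith
  -- Both frequencies are shifted by 4 to meet the bound needed for `modulation`. The difference is
  -- then `4(β - α)` minus a rounding error in `[0, β)`, whence the bound `4(α + β)`.
  refine ⟨N, fun j => ⌊α * N * j / β⌋₊ + 4, 4 * (α + β), by exact_mod_cast hN1, fun j => Nat.le_add_left _ _,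
    StrictMono.injective (strictMono_nat_of_lt_succ fun j => ?_), by positivity, fun j => ?_⟩
  · have h1 : ⌊α * N * j / β⌋₊ + 1 ≤ ⌊α * N * (j + 1 : ℕ) / β⌋₊ := by
      rw [← Nat.floor_add_one (by positivity)]
      apply Nat.floor_le_floor
      rw [div_add_one hβ.ne']
      gcongr
      push_cast
      nlinarith
    exact Nat.add_lt_add_right h1 4
  · have h0 : 0 ≤ α * N * j / β := by positivity
    have h1 := Nat.floor_le h0
    have h2 := Nat.lt_floor_add_one (α * N * j / β)
    rw [le_div_iff₀ hβ] at h1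
    rw [div_lt_iff₀ hβ] at h2
    rw [abs_le]
    push_cast
    constructor <;> nlinarith

theorem proposition3 (φ ψ : ℕ → 𝓢(ℝ, ℂ)) (hφ : IsLittlewoodPaley φ) (hψ : IsLittlewoodPaley ψ)
    (s t α β θ : ℝ) (hα : 0 < α) (hβ : 0 < β) (hθ : θ ∈ Set.Icc (0 : ℝ) 1)
    (p r : ℝ≥0∞) [Fact (1 ≤ r)] (hp : 1 < p) (hp' : p < ∞) (hr : 1 < r) (hr' : r < ∞)
    (u q : ℝ≥0∞) (hu : 1 ≤ u) (huq : u < q) :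
    ¬ (TriebelLizorkinBesov φ ψ (s + α) p q t r 1 ∩
          TriebelLizorkinBesov φ ψ s p q (t + β) r 1 ⊆
        TriebelLizorkinBesov φ ψ (s + (1 - θ) * α) p u (t + θ * β) r ∞) := by
  obtain ⟨N, n, D, hN, hn, hninj, hD, hbal⟩ := exists_balanced_frequencies hα hβ
  let m : ℕ → ℕ := fun j => N * j + 4
  have hm : ∀ j, 4 ≤ m j := fun j => by simp [m]
  have hminj : m.Injective := fun i j h => by
    simpa [m, Nat.pos_iff_ne_zero.1 hN] using h
  have hbal' : ∀ j, |β * n j - α * m j| ≤ D := hbal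
  let a : ℕ → ℝ := fun k => ((k : ℝ) + 1) ^ (-(1 / u.toReal))
  have ha0 : ∀ k, 0 ≤ a k := fun k => by positivity
  have ha1 : ∀ k, a k ≤ 1 := fun k =>
    Real.rpow_le_one_of_one_le_of_nonpos (by linarith [Nat.cast_nonneg (α := ℝ) k]) (by simp)
  -- Normalized so that the weighted coefficient at the corner `(s + α, t)` is exactly `a (m j)`.
  let A : ℕ → ℝ := fun j => a (m j) * 2 ^ (-((s + α) * m j + t * n j))
  have hA : ∀ j, 0 ≤ A j := fun j => mul_nonneg (ha0 _) (by positivity)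
  have hprod : ∀ (σ τ : ℝ) (j : ℕ), 2 ^ (σ * (m j : ℝ)) * (2 ^ (τ * (n j : ℝ)) * A j) =
      2 ^ ((σ - (s + α)) * m j + (τ - t) * n j) * a (m j) := by
    intro σ τ j
    rw [show A j = 2 ^ (-((s + α) * m j + t * n j)) * a (m j) from mul_comm _ _, ← mul_assoc, ← mul_assoc, ← Real.rpow_add two_pos,
      ← Real.rpow_add two_pos]
    congr 2
    ring
  have hgrowth : ∀ τ : ℝ, ∃ (K : ℝ) (M : ℕ), ∀ j,
      2 ^ (τ * (n j : ℝ)) * A j ≤ K * (2 ^ m j) ^ M := by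
    intro τ
    obtain ⟨M, hM⟩ := exists_nat_ge (|τ - t| * (α / β) + |s + α|)
    refine ⟨2 ^ (|τ - t| * (D / β)), M, fun j => ?_⟩
    -- Balance turns powers of `2 ^ n j` into powers of `2 ^ m j`, which the decay of the
    -- modulations can absorb.
    have h1 : (n j : ℝ) ≤ α / β * m j + D / β := by
      have := (abs_le.1 (hbal' j)).2
      rw [div_mul_eq_mul_div, ← add_div, le_div_iff₀ hβ]
      linarith
    have h2 : (0 - (s + α)) * m j + (τ - t) * n j ≤ |τ - t| * (D / β) + m j * M := by
      calc (0 - (s + α)) * m j + (τ - t) * n j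
          ≤ |s + α| * m j + |τ - t| * (α / β * m j + D / β) := by
            gcongr
            · rw [zero_sub]; exact neg_le_abs _
            · exact le_abs_self _
        _ = |τ - t| * (D / β) + m j * (|τ - t| * (α / β) + |s + α|) := by ring
        _ ≤ _ := by gcongr
    have h3 := hprod 0 τ j
    rw [zero_mul, Real.rpow_zero, one_mul] at h3
    rw [h3]
    calc _ ≤ (2 : ℝ) ^ (|τ - t| * (D / β) + m j * M) * 1 :=
          mul_le_mul (Real.rpow_le_rpow_of_exponent_le one_le_two h2) (ha1 _) (ha0 _)
            (by positivity)
      _ = _ := by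
          rw [mul_one, Real.rpow_add two_pos, Real.rpow_mul two_pos.le (m j : ℝ),
            Real.rpow_natCast, Real.rpow_natCast]
  obtain ⟨K, M, hK⟩ := hgrowth 0
  obtain ⟨T, hT⟩ := exists_diagonalOperator hφ hψ hm hn hminj hA (K := K) (M := M)
    (fun j => by simpa using hK j)
  have hmem : ∀ σ τ : ℝ, (∃ c : ℝ, 0 ≤ c ∧ ∀ j,
      (2 : ℝ) ^ ((σ - (s + α)) * m j + (τ - t) * n j) ≤ c) →
      T ∈ TriebelLizorkinBesov φ ψ σ p q τ r 1 := by
    rintro σ τ ⟨c, hc, h⟩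
    obtain ⟨K, M, hK⟩ := hgrowth τ
    obtain ⟨f, hf⟩ :=
      exists_besov_valued_diagonalOperator hφ hψ hm hn hminj hninj hA hT r hK
    refine ⟨f, triebelLizorkinNorm_diagonalOperator_lt_top hφ hψ hm hn hminj hninj hA hT hf
      (eLpNorm_rpow_count_lt_top hu huq) hc fun j => ?_, hf⟩
    rw [hprod, Real.norm_of_nonneg (ha0 _)]
    exact mul_le_mul_of_nonneg_right (h j) (ha0 _)
  intro hsub
  -- The weight exponent is 0 at the first corner and `β n_j - α m_j ≤ D` at the second.
  obtain ⟨f, hfin, hf⟩ := hsub ⟨hmem (s + α) t ⟨1, zero_le_one, fun j => by simp⟩,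
    hmem s (t + β) ⟨2 ^ D, by positivity, fun j =>
      Real.rpow_le_rpow_of_exponent_le one_le_two (by linarith [(abs_le.1 (hbal' j)).2])⟩⟩
  refine ne_of_lt hfin (triebelLizorkinNorm_diagonalOperator_eq_top hφ hψ hm hn hminj hninj hA hT hf
    (zero_lt_one.trans hp).ne' hp'.ne
    (eLpNorm_indicator_rpow_count_eq_top hu (huq.trans_le le_top) hN)
    (c := 2 ^ (-D)) (by positivity) fun j => ?_)
  rw [hprod, Real.norm_of_nonneg (ha0 _)]
  refine mul_le_mul_of_nonneg_right (Real.rpow_le_rpow_of_exponent_le one_le_two ?_) (ha0 _)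
  -- At the intermediate point the exponent is `θ (β n_j - α m_j)`, which is at least `-D` because
  -- `0 ≤ θ ≤ 1`.
  have h1 : θ * |β * n j - α * m j| ≤ D :=
    (mul_le_of_le_one_left (abs_nonneg _) hθ.2).trans (hbal' j)
  have h2 : θ * -|β * n j - α * m j| ≤ θ * (β * n j - α * m j) :=
    mul_le_mul_of_nonneg_left (neg_abs_le _) hθ.1
  linarith
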